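/- Let $R,T,\beta,\kappa,\tau,c_t>0$ and $\vartheta_0,\alpha,\lambda\in\mathbb R$, and let $c_m,c_M,\varepsilon_0$ satisfy $0<c_m\le c_M$ and $\beta c_M\le\varepsilon_0<1$. Put $$G(c)=\sqrt{\lambda c-c\ln(1-\beta c)},\qquad \mu_{\rm att}(c)=\frac{\alpha}{2\sqrt2\,\beta}\ln\frac{1+(1-\sqrt2)\beta c}{1+(1+\sqrt2)\beta c}-\frac{\alpha c}{1+2\beta c-(\beta c)^2},$$ $$\nu(c)=RT\Big(\frac1c+G'(c)^2\Big),\qquad s_r(c)=-\vartheta_0-RT\ln c+RT\big(G'(c)^2c-2G(c)G'(c)+\lambda\big)-\mu_{\rm att}(c).$$ Let $\Omega\subset\mathbb R^d$ be an open set of finite Lebesgue measure (for instance a bounded, connected, smooth domain), and let $c^n:\Omega\to\mathbb R$ be measurable. Consider one step of the semi-implicit scheme $$\frac{c^{n+1}-c^n}{\tau}-\kappa\Delta c^{n+1}+\mu_{\rm ideal}^{n+1}+\mu_{\rm rep}^{n+1}+\mu_{\rm att}(c^n)=\mu_e^{n+1}\ \text{ in }\Omega,\qquad \int_\Omega c^{n+1}\,dx=c_t,\qquad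 \nabla c^{n+1}\cdot n=0\ \text{ on }\partial\Omega,$$ where $$\mu_{\rm ideal}^{n+1}=\vartheta_0+RT\ln c^n+RT\frac{c^{n+1}}{c^n},\qquad \mu_{\rm rep}^{n+1}=RT\,G'(c^n)\big(2G(c^n)+G'(c^n)(c^{n+1}-c^n)\big)-\lambda RT .$$ A weak solution is a pair $(c^{n+1},\mu_e^{n+1})\in H^1(\Omega)\times\mathbb R$ with $\int_\Omega c^{n+1}dx=c_t$ and, for every $v\in H^1(\Omega)$, $$\int_\Omega\Big(\frac{c^{n+1}-c^n}{\tau}\,v+\kappa\nabla c^{n+1}\cdot\nabla v+\big(\mu_{\rm ideal}^{n+1}+\mu_{\rm rep}^{n+1}+\mu_{\rm att}(c^n)\big)v\Big)dx=\int_\Omega\mu_e^{n+1}v\,dx .$$ **Theorem 4.2.** Assume that $c_m\le c^n\le c_M$ almost everywhere in $\Omega$ and that $$\lambda\ \ge\ \frac{\varepsilon_0}{(1-\varepsilon_0)^2}+\left(\frac{\varepsilon_0^2}{(1-\varepsilon_0)^4}-2\ln(1-\varepsilon_0)\,\frac{\varepsilon_0}{(1-\varepsilon_0)^2}\right)^{1/2}.$$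 Let $(c^{n+1},\mu_e^{n+1})$ be a weak solution of the step above. If $$\max_{c_m\le c\le c_M}\big(c_m\nu(c)-s_r(c)\big)\ \le\ \mu_e^{n+1}\ \le\ \min_{c_m\le c\le c_M}\big(c_M\nu(c)-s_r(c)\big),$$ then $c_m\le c^{n+1}\le c_M$ almost everywhere in $\Omega$. -/

import Mathlib

open MeasureTheory Set
open scoped ContDiff

noncomputable section

/-- The space `ℝᵈ` with its Euclidean norm and Lebesgue measure. -/
abbrev Space (d : ℕ) : Type := EuclideanSpace ℝ (Fin d)

/-! ### The Sobolev space `H¹(Ω)` -/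

/-- `g` is the weak (distributional) gradient of `u` on the open set `Ω`: both are locally
integrable on `Ω`, and `∫_Ω u ∂ᵢφ = - ∫_Ω gᵢ φ` for every `φ ∈ C_c^∞(Ω)` and every `i`. -/
def IsWeakGradient {d : ℕ} (Ω : Set (Space d)) (u : Space d → ℝ) (g : Space d → Space d) : Prop :=
  LocallyIntegrableOn u Ω volume ∧ LocallyIntegrableOn g Ω volume ∧
  ∀ φ : Space d → ℝ, ContDiff ℝ ∞ φ → HasCompactSupport φ → tsupport φ ⊆ Ω →
    ∀ i : Fin d,
      ∫ x in Ω, u x * fderiv ℝ φ x (EuclideanSpace.single i (1 : ℝ)) = - ∫ x in Ω, g x i * φ x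

/-- `u ∈ H¹(Ω)` with `∇u = g`: both `u` and its weak gradient `g` are square integrable on `Ω`.
The gradient `g` is determined by `u` up to a null set. -/
structure HasH1Gradient {d : ℕ} (Ω : Set (Space d)) (u : Space d → ℝ)
    (g : Space d → Space d) : Prop where
  memLp : MemLp u 2 (volume.restrict Ω)
  memLp_grad : MemLp g 2 (volume.restrict Ω)
  isWeakGradient : IsWeakGradient Ω u g

/-! ### The Peng–Robinson fluid and the energy factorization -/

/-- Data of a Peng–Robinson fluid at a fixed temperature. -/
structure PRFluid where
  /-- universal gas constant `R` -/
  R : ℝ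
  /-- temperature `T` -/
  T : ℝ
  /-- energy parameter `ϑ₀` of the ideal part -/
  theta0 : ℝ
  /-- attraction parameter `α = α(T)` -/
  α : ℝ
  /-- effective volume `β` of one mole -/
  β : ℝ
  /-- influence parameter `κ` of the gradient energy -/
  κ : ℝ

namespace PRFluid

variable (F : PRFluid)

/-- `G(c) = √(λ c - c ln(1 - β c))`. -/
def G (lam c : ℝ) : ℝ := √(lam * c - c * Real.log (1 - F.β * c))

/-- `G'(c)`. -/
def G' (lam c : ℝ) : ℝ := deriv (F.G lam) c

/-- Ideal part of the chemical potential at the new step; `c0 = cⁿ`, `c1 = cⁿ⁺¹`. -/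
def muIdeal (c0 c1 : ℝ) : ℝ :=
  F.theta0 + F.R * F.T * Real.log c0 + F.R * F.T * (c1 / c0)

/-- Repulsion part of the chemical potential at the new step: with the linearization
`Gⁿ⁺¹ = G(cⁿ) + G'(cⁿ)(cⁿ⁺¹ - cⁿ)`, it is `RT G'(cⁿ)(Gⁿ⁺¹ + G(cⁿ)) - λRT`. -/
def muRepulsion (lam c0 c1 : ℝ) : ℝ :=
  F.R * F.T * F.G' lam c0 * ((F.G lam c0 + F.G' lam c0 * (c1 - c0)) + F.G lam c0)
    - lam * (F.R * F.T)

/-- Attraction part of the chemical potential, treated explicitly. -/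
def muAttraction (c : ℝ) : ℝ :=
  F.α / (2 * √2 * F.β) *
      Real.log ((1 + (1 - √2) * F.β * c) / (1 + (1 + √2) * F.β * c))
    - F.α * c / (1 + 2 * F.β * c - (F.β * c) ^ 2)

/-- `ν(c) = RT (1/c + G'(c)²)`. -/
def nu (lam c : ℝ) : ℝ := F.R * F.T * (1 / c + F.G' lam c ^ 2)

/-- `s_r(c) = -ϑ₀ - RT ln c + RT (G'(c)² c - 2 G(c) G'(c) + λ) - μ_attraction(c)`. -/
def sr (lam c : ℝ) : ℝ :=
  -F.theta0 - F.R * F.T * Real.log c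
    + F.R * F.T * (F.G' lam c ^ 2 * c - 2 * F.G lam c * F.G' lam c + lam) - F.muAttraction c

/-- One step of the semi-implicit time-discrete scheme, solved weakly in `H¹(Ω)`:
given `c0 = cⁿ`, the pair `(c1, μe) = (cⁿ⁺¹, μₑⁿ⁺¹)` (a function in `H¹(Ω)` and a real constant)
satisfies
`(c1 - c0)/τ - κ Δc1 + μ_ideal + μ_repulsion + μ_attraction(c0) = μe` in `Ω`,
`∫_Ω c1 = ct` and `∇c1 · n = 0` on `∂Ω`. The Neumann condition is the natural one, encoded by
testing with all of `H¹(Ω)`. -/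
def IsWeakStep {d : ℕ} (Ω : Set (Space d)) (lam τ ct : ℝ) (c0 c1 : Space d → ℝ) (μe : ℝ) :
    Prop :=
  (∃ g : Space d → Space d, HasH1Gradient Ω c1 g ∧
    ∀ (v : Space d → ℝ) (gv : Space d → Space d), HasH1Gradient Ω v gv →
      ∫ x in Ω, ((c1 x - c0 x) / τ * v x + F.κ * inner ℝ (g x) (gv x)
          + (F.muIdeal (c0 x) (c1 x) + F.muRepulsion lam (c0 x) (c1 x)
              + F.muAttraction (c0 x)) * v x)
        = ∫ x in Ω, μe * v x) ∧
  ∫ x in Ω, c1 x = ct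

end PRFluid

end

/-!
The chemical potential of the scheme is affine in the new concentration, so one step reads
`(c1 - c0) / τ - κ Δc1 + ν(c0) c1 - s_r(c0) = μe`, with `ν ≥ 0`
(`PRFluid.mu_sum_eq_nu_mul_sub_sr`). Write `r = (c1 - c0) / τ + ν(c0) c1 - s_r(c0) - μe`, so that
the equation is `r = κ Δc1`. The bounds on `μe` say that `r > 0` wherever `c1 > cM` and `r < 0`
wherever `c1 < cm`, and the weak maximum principle excludes both.

The usual test functions are the truncations `(c1 - cM)⁺` and `(c1 - cm)⁻`. Since only their sign
and monotonicity in `c1` matter, they are replaced by the smooth bounded functions `S(c1 - cM)` and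
`-S(cm - c1)`, where `S = Real.smoothTransition` vanishes exactly on `(-∞, 0]`. Testing with such a
`ψ(c1)` gives `∫ (r ψ(c1) + κ ψ'(c1) |∇c1|²) = 0` with both terms nonnegative, hence `ψ(c1) = 0`
almost everywhere (`HasH1Gradient.comp_ae_eq_zero`).

That `ψ(c1)` belongs to `H¹(Ω)` with gradient `ψ'(c1) ∇c1` is the chain rule `HasH1Gradient.comp`,
obtained by mollification: mollified functions converge almost everywhere, and their gradients
converge in `L¹` (`tendsto_integral_abs_mollify_sub`), which is enough to pass to the limit in the
integration by parts formula.

The hypothesis on `λ` enters through `λ > 0`: it makes `G` continuously differentiable on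
`[cm, cM]`, so that `ν` and `s_r` are continuous there. Hence the supremum and infimum that
bound `μe` are finite, and the coefficients of the equation are bounded.
-/

/-! ### Mollification -/

open Filter Topology ContinuousLinearMap in
/-- `L¹` convergence of mollifications of a nonnegative `f`. Mollification preserves the integral,
so `‖fₖ - f‖₁` is twice the integral of `(f - fₖ)⁺`, which is dominated by `f`
(Scheffé's argument). -/
theorem tendsto_integral_abs_mollify_sub_of_nonneg {d : ℕ}
    {ρ : ℕ → ContDiffBump (0 : Space d)} (hρ : Tendsto (fun k => (ρ k).rOut) atTop (𝓝 0))
    {K : ℝ} (hK : ∀ k, (ρ k).rOut ≤ K * (ρ k).rIn) {f : Space d → ℝ} (hf : Integrable f)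
    (hf0 : ∀ x, 0 ≤ f x) :
    Tendsto (fun k => ∫ x, |convolution ((ρ k).normed volume) f (lsmul ℝ ℝ) volume x - f x|)
      atTop (𝓝 0) := by
  set m : ℕ → Space d → ℝ := fun k => convolution ((ρ k).normed volume) f (lsmul ℝ ℝ) volume
    with hm
  have hint : ∀ k, Integrable (m k) := fun k =>
    Integrable.integrable_convolution _ ((ρ k).integrable_normed) hf
  have hmean : ∀ k, ∫ x, m k x = ∫ x, f x := fun k => by
    rw [hm, integral_convolution (lsmul ℝ ℝ) ((ρ k).integrable_normed) hf]
    simp [(ρ k).integral_normed]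
  have hm0 : ∀ k x, 0 ≤ m k x := fun k x =>
    integral_nonneg fun t => mul_nonneg ((ρ k).nonneg_normed t) (hf0 _)
  have hpos : ∀ k, Integrable (fun x => max (f x - m k x) 0) := fun k =>
    (hf.sub (hint k)).pos_part
  have key : ∀ k, ∫ x, |m k x - f x| = 2 * ∫ x, max (f x - m k x) 0 := fun k => by
    have h1 : ∀ x, |m k x - f x| = (m k x - f x) + 2 * max (f x - m k x) 0 := fun x => by
      rcases le_total (f x) (m k x) with h | h
      · rw [abs_of_nonneg (by linarith), max_eq_right (by linarith)]; ring
      · rw [abs_of_nonpos (by linarith), max_eq_left (by linarith)]; ring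
    simp_rw [h1]
    have h2 : Integrable (fun x => m k x - f x) := (hint k).sub hf
    rw [integral_add h2 ((hpos k).const_mul 2), integral_sub (hint k) hf, hmean,
      integral_const_mul]
    ring
  change Tendsto (fun k => ∫ x, |m k x - f x|) atTop (𝓝 0)
  simp_rw [key]
  have hae := ContDiffBump.ae_convolution_tendsto_right_of_locallyIntegrable (μ := volume) hρ
    (Eventually.of_forall hK) hf.locallyIntegrable
  have : Tendsto (fun k => ∫ x, max (f x - m k x) 0) atTop (𝓝 (∫ _ : Space d, (0 : ℝ))) := by
    refine tendsto_integral_of_dominated_convergence f (fun k => (hpos k).aestronglyMeasurable)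
      hf (fun k => Eventually.of_forall fun x => ?_) ?_
    · rw [Real.norm_of_nonneg (le_max_right _ _)]
      exact max_le (by linarith [hm0 k x]) (hf0 x)
    · filter_upwards [hae] with x hx
      have := ((tendsto_const_nhds (x := f x)).sub hx).max (tendsto_const_nhds (x := (0 : ℝ)))
      simpa using this
  simpa using this.const_mul 2

open Filter Topology ContinuousLinearMap in
/-- Mollifications of an integrable function converge to it in `L¹`: the nonnegative case applied
to the positive and negative parts. -/
theorem tendsto_integral_abs_mollify_sub {d : ℕ}
    {ρ : ℕ → ContDiffBump (0 : Space d)} (hρ : Tendsto (fun k => (ρ k).rOut) atTop (𝓝 0))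
    {K : ℝ} (hK : ∀ k, (ρ k).rOut ≤ K * (ρ k).rIn) {f : Space d → ℝ} (hf : Integrable f) :
    Tendsto (fun k => ∫ x, |convolution ((ρ k).normed volume) f (lsmul ℝ ℝ) volume x - f x|)
      atTop (𝓝 0) := by
  have hp := hf.pos_part
  have hn := hf.neg_part
  have hsum := (tendsto_integral_abs_mollify_sub_of_nonneg hρ hK hp
    fun x => le_max_right _ _).add (tendsto_integral_abs_mollify_sub_of_nonneg hρ hK hn
    fun x => le_max_right _ _)
  rw [add_zero] at hsum
  have hdiff : ∀ {h : Space d → ℝ}, Integrable h → ∀ k, Integrable fun x =>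
      |convolution ((ρ k).normed volume) h (lsmul ℝ ℝ) volume x - h x| := fun hh k =>
    ((Integrable.integrable_convolution _ ((ρ k).integrable_normed) hh).sub hh).abs
  refine squeeze_zero (fun k => integral_nonneg fun x => abs_nonneg _) (fun k => ?_) hsum
  rw [← integral_add (hdiff hp k) (hdiff hn k)]
  refine integral_mono_ae (hdiff hf k) ((hdiff hp k).add (hdiff hn k))
    (Eventually.of_forall fun x => ?_)
  have hex : ∀ {h : Space d → ℝ}, Integrable h →
      Integrable (fun t => (ρ k).normed volume t * h (x - t)) := fun {h} hh =>
    ((ρ k).hasCompactSupport_normed.convolutionExists_left (lsmul ℝ ℝ)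
      ((ρ k).contDiff_normed (n := 0)).continuous hh.locallyIntegrable x)
  have hsplit : convolution ((ρ k).normed volume) f (lsmul ℝ ℝ) volume x
      = convolution ((ρ k).normed volume) (fun a => max (f a) 0) (lsmul ℝ ℝ) volume x
        - convolution ((ρ k).normed volume) (fun a => max (-f a) 0) (lsmul ℝ ℝ) volume x := by
    simp only [convolution_def, lsmul_apply, smul_eq_mul]
    rw [← integral_sub (hex hp) (hex hn)]
    refine integral_congr_ae (Eventually.of_forall fun t => ?_)
    change _ = _ * max (f (x - t)) 0 - _ * max (-f (x - t)) 0
    rw [← mul_sub, max_zero_sub_max_neg_zero_eq_self]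
  have hfx : f x = max (f x) 0 - max (-f x) 0 := (max_zero_sub_max_neg_zero_eq_self _).symm
  change |convolution ((ρ k).normed volume) f (lsmul ℝ ℝ) volume x - f x| ≤ _
  rw [hsplit]
  conv_lhs => rw [hfx]
  rw [sub_sub_sub_comm]
  exact abs_sub _ _

open Filter Topology ContinuousLinearMap in
/-- At points whose distance to the complement of `Ω` exceeds the mollification radius,
the gradient of the mollified function is the mollified weak gradient: the shifted kernel
`y ↦ η (x - y)` is then an admissible test function. Both `u` and `g` are extended by zero. -/
theorem IsWeakGradient.fderiv_mollify {d : ℕ} {Ω : Set (Space d)} {u : Space d → ℝ}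
    {g : Space d → Space d} (h : IsWeakGradient Ω u g) (hΩ : MeasurableSet Ω)
    (hu : IntegrableOn u Ω) (ρ : ContDiffBump (0 : Space d)) {x : Space d}
    (hx : Metric.closedBall x ρ.rOut ⊆ Ω) (i : Fin d) :
    fderiv ℝ (convolution (ρ.normed volume) (Ω.indicator u) (lsmul ℝ ℝ) volume) x
        (EuclideanSpace.single i 1)
      = convolution (ρ.normed volume) (Ω.indicator fun y => g y i) (lsmul ℝ ℝ) volume x := by
  set η := ρ.normed volume with hη
  have hηc : ContDiff ℝ ∞ η := ρ.contDiff_normed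
  have hU : Integrable (Ω.indicator u) := hu.integrable_indicator hΩ
  set e : Space d := EuclideanSpace.single i 1
  have hex := (ρ.hasCompactSupport_normed.fderiv ℝ).convolutionExists_left
      ((lsmul ℝ ℝ).precompL (Space d)) (hηc.continuous_fderiv (by simp)) hU.locallyIntegrable x
  rw [(ρ.hasCompactSupport_normed.hasFDerivAt_convolution_left (lsmul ℝ ℝ)
    (hηc.of_le (by simp)) hU.locallyIntegrable x).fderiv, convolution_def,
    ContinuousLinearMap.integral_apply hex]
  simp only [precompL_apply, lsmul_apply, smul_eq_mul]
  -- The test function; the chain rule through `x - y` gives it a sign opposite to that of `∇η`.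
  set φ : Space d → ℝ := fun y => η (x - y) with hφ
  have hφc : ContDiff ℝ ∞ φ := hηc.comp (contDiff_const.sub contDiff_id)
  have hsupp : tsupport φ ⊆ Metric.closedBall x ρ.rOut := by
    refine closure_minimal (fun y hy => ?_) Metric.isClosed_closedBall
    have : x - y ∈ Function.support η := hy
    rw [hη, ρ.support_normed_eq] at this
    rw [Metric.mem_closedBall, dist_comm, dist_eq_norm]
    exact (mem_ball_zero_iff.1 this).le
  have hφs : HasCompactSupport φ :=
    (isCompact_closedBall x ρ.rOut).of_isClosed_subset (isClosed_tsupport φ) hsupp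
  have hfd : ∀ y, fderiv ℝ φ y e = - fderiv ℝ η (x - y) e := fun y => by
    have h1 : HasFDerivAt η (fderiv ℝ η (x - y)) (x - y) :=
      (hηc.differentiable (by simp) _).hasFDerivAt
    have h2 := h1.comp y ((hasFDerivAt_id y).const_sub x)
    have h3 : fderiv ℝ φ y = _ := h2.fderiv
    rw [h3]
    simp
  have hw := h.2.2 φ hφc hφs (hsupp.trans hx) i
  calc ∫ t, fderiv ℝ η t e * Ω.indicator u (x - t)
      = ∫ y, fderiv ℝ η (x - y) e * Ω.indicator u y := by
        rw [← integral_sub_left_eq_self _ volume x]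
        simp
    _ = - ∫ y in Ω, u y * fderiv ℝ φ y e := by
        rw [← integral_indicator hΩ, ← integral_neg]
        refine integral_congr_ae (Eventually.of_forall fun y => ?_)
        by_cases hy : y ∈ Ω
        · simp [hy, hfd, mul_comm]
        · simp [hy]
    _ = ∫ y in Ω, g y i * φ y := by rw [hw, neg_neg]
    _ = ∫ y, φ y * Ω.indicator (fun y => g y i) y := by
        rw [← integral_indicator hΩ]
        refine integral_congr_ae (Eventually.of_forall fun y => ?_)
        by_cases hy : y ∈ Ω
        · simp [hy, mul_comm]
        · simp [hy]
    _ = _ := by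
        rw [convolution_def, ← integral_sub_left_eq_self _ volume x]
        simp [hφ]

/-! ### Chain rule in `H¹` -/

open Filter Topology ContinuousLinearMap in
/-- The identity defining the weak gradient, for `ψ ∘ u`: integrate by parts with the
mollifications `uₖ` of `u`, then let `k → ∞`. Since `uₖ → u` almost everywhere and `∇uₖ → g` in
`L¹`, boundedness of `ψ` and `ψ'` suffices for the passage to the limit. -/
theorem IsWeakGradient.integral_comp_mul_fderiv {d : ℕ} {Ω : Set (Space d)} {u : Space d → ℝ}
    {g : Space d → Space d} (h : IsWeakGradient Ω u g) (hΩ : IsOpen Ω)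
    (hu : IntegrableOn u Ω) (hg : IntegrableOn g Ω) {ψ : ℝ → ℝ} (hψ : ContDiff ℝ 1 ψ) {C : ℝ}
    (hψC : ∀ s, |ψ s| ≤ C) (hψC' : ∀ s, |deriv ψ s| ≤ C) {φ : Space d → ℝ}
    (hφ : ContDiff ℝ ∞ φ) (hφs : HasCompactSupport φ) (hφΩ : tsupport φ ⊆ Ω) (i : Fin d) :
    ∫ x in Ω, ψ (u x) * fderiv ℝ φ x (EuclideanSpace.single i (1 : ℝ))
      = - ∫ x in Ω, deriv ψ (u x) * g x i * φ x := by
  set e : Space d := EuclideanSpace.single i 1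
  set U := Ω.indicator u with hUdef
  set γ : Space d → ℝ := Ω.indicator fun y => g y i with hγdef
  have hU : Integrable U := hu.integrable_indicator hΩ.measurableSet
  have hγ : Integrable γ := by
    refine IntegrableOn.integrable_indicator ?_ hΩ.measurableSet
    exact (EuclideanSpace.proj (𝕜 := ℝ) (ι := Fin d) i).integrable_comp hg
  have hψ' : Continuous (deriv ψ) := hψ.continuous_deriv_one
  have hφc : Continuous φ := hφ.continuous
  have hφdc : Continuous fun x => fderiv ℝ φ x e :=
    (hφ.continuous_fderiv (by simp)).clm_apply continuous_const
  have hφds : HasCompactSupport fun x => fderiv ℝ φ x e := hφs.fderiv_apply ℝ e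
  have hφdi : Integrable fun x => fderiv ℝ φ x e := hφdc.integrable_of_hasCompactSupport hφds
  obtain ⟨M, hM⟩ := hφs.exists_bound_of_continuous hφc
  have hC0 : 0 ≤ C := (abs_nonneg _).trans (hψC 0)
  -- Bump functions with radii tending to `0` and bounded ratio `rOut / rIn`, as needed for
  -- almost everywhere convergence.
  let ρ : ℕ → ContDiffBump (0 : Space d) := fun k =>
    { rIn := 1 / ((k : ℝ) + 1) / 2
      rOut := 1 / ((k : ℝ) + 1)
      rIn_pos := by positivity
      rIn_lt_rOut := half_lt_self (by positivity) }
  have hρ : Tendsto (fun k => (ρ k).rOut) atTop (𝓝 0) :=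
    tendsto_one_div_add_atTop_nhds_zero_nat
  have hK : ∀ k, (ρ k).rOut ≤ 2 * (ρ k).rIn := fun k => by
    change 1 / ((k : ℝ) + 1) ≤ 2 * (1 / ((k : ℝ) + 1) / 2)
    linarith
  set m : ℕ → Space d → ℝ := fun k => convolution ((ρ k).normed volume) U (lsmul ℝ ℝ) volume
    with hm
  set n : ℕ → Space d → ℝ := fun k => convolution ((ρ k).normed volume) γ (lsmul ℝ ℝ) volume
    with hn
  have hmc : ∀ k, ContDiff ℝ ∞ (m k) := fun k =>
    (ρ k).hasCompactSupport_normed.contDiff_convolution_left _ (ρ k).contDiff_normed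
      hU.locallyIntegrable
  have hnint : ∀ k, Integrable (n k) := fun k =>
    Integrable.integrable_convolution _ ((ρ k).integrable_normed) hγ
  have hmae : ∀ᵐ x, Tendsto (fun k => m k x) atTop (𝓝 (U x)) :=
    ContDiffBump.ae_convolution_tendsto_right_of_locallyIntegrable hρ
      (Eventually.of_forall hK) hU.locallyIntegrable
  have hn1 : Tendsto (fun k => ∫ x, |n k x - γ x|) atTop (𝓝 0) :=
    tendsto_integral_abs_mollify_sub hρ hK hγ
  -- Integration by parts for `ψ ∘ uₖ`, once the mollification radius is below the distance from
  -- the support of `φ` to the complement of `Ω`.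
  have hparts : ∀ᶠ k in atTop, ∫ x, ψ (m k x) * fderiv ℝ φ x e
      = - ∫ x, deriv ψ (m k x) * n k x * φ x := by
    obtain ⟨δ, hδ, hδΩ⟩ := hφs.isCompact.exists_cthickening_subset_open hΩ hφΩ
    filter_upwards [hρ.eventually_lt_const hδ] with k hk
    have hψm : ContDiff ℝ 1 (fun x => ψ (m k x)) := hψ.comp ((hmc k).of_le (by simp))
    have hcd : Continuous fun x => fderiv ℝ (fun x => ψ (m k x)) x e :=
      (hψm.continuous_fderiv (by simp)).clm_apply continuous_const
    rw [integral_mul_fderiv_eq_neg_fderiv_mul_of_integrable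
      ((hcd.mul hφc).integrable_of_hasCompactSupport hφs.mul_left)
      ((hψm.continuous.mul hφdc).integrable_of_hasCompactSupport hφds.mul_left)
      ((hψm.continuous.mul hφc).integrable_of_hasCompactSupport hφs.mul_left)
      (fun x _ => hψm.differentiable (by simp) x) (fun x _ => hφ.differentiable (by simp) x)]
    congr 1
    refine integral_congr_ae (Eventually.of_forall fun x => ?_)
    by_cases hx : x ∈ tsupport φ
    · have h1 : HasDerivAt ψ (deriv ψ (m k x)) (m k x) :=
        (hψ.differentiable (by simp) _).hasDerivAt
      have h2 : HasFDerivAt (m k) (fderiv ℝ (m k) x) x :=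
        ((hmc k).differentiable (by simp) x).hasFDerivAt
      have h3 : fderiv ℝ (fun x => ψ (m k x)) x = _ := (h1.comp_hasFDerivAt x h2).fderiv
      have h4 : fderiv ℝ (m k) x e = n k x :=
        h.fderiv_mollify hΩ.measurableSet hu (ρ k)
          (((Metric.closedBall_subset_closedBall hk.le).trans
            (Metric.closedBall_subset_cthickening hx δ)).trans hδΩ) i
      simp only [h3, smul_apply, h4, smul_eq_mul]
    · simp [image_eq_zero_of_notMem_tsupport hx]
  have hlim1 : Tendsto (fun k => ∫ x, ψ (m k x) * fderiv ℝ φ x e) atTop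
      (𝓝 (∫ x, ψ (U x) * fderiv ℝ φ x e)) := by
    refine tendsto_integral_of_dominated_convergence (fun x => C * |fderiv ℝ φ x e|)
      (fun k => ((hψ.continuous.comp (hmc k).continuous).mul hφdc).aestronglyMeasurable)
      (hφdi.abs.const_mul C) (fun k => Eventually.of_forall fun x => ?_) ?_
    · rw [Real.norm_eq_abs, abs_mul]
      exact mul_le_mul_of_nonneg_right (hψC _) (abs_nonneg _)
    · filter_upwards [hmae] with x hx
      exact ((hψ.continuous.tendsto _).comp hx).mul_const _
  have hbd : ∀ k x, ‖deriv ψ (m k x) * φ x‖ ≤ C * M := fun k x => by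
    rw [norm_mul]
    exact mul_le_mul (hψC' _) (hM x) (norm_nonneg _) hC0
  have hcont : ∀ k, Continuous fun x => deriv ψ (m k x) * φ x := fun k =>
    (hψ'.comp (hmc k).continuous).mul hφc
  -- `∫ ψ'(uₖ) (∇uₖ) φ = ∫ ψ'(uₖ) (∇uₖ - g) φ + ∫ ψ'(uₖ) g φ`; `L¹` convergence of the gradients
  -- handles the first term, dominated convergence the second.
  have hlim2 : Tendsto (fun k => ∫ x, (deriv ψ (m k x) * φ x) * (n k x - γ x)) atTop (𝓝 0) := by
    refine squeeze_zero_norm (fun k => ?_) (by simpa using hn1.const_mul (C * M))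
    rw [← integral_const_mul]
    refine norm_integral_le_of_norm_le (((hnint k).sub hγ).abs.const_mul (C * M))
      (Eventually.of_forall fun x => ?_)
    rw [norm_mul]
    exact mul_le_mul_of_nonneg_right (hbd k x) (norm_nonneg _)
  have hlim3 : Tendsto (fun k => ∫ x, (deriv ψ (m k x) * φ x) * γ x) atTop
      (𝓝 (∫ x, (deriv ψ (U x) * φ x) * γ x)) := by
    refine tendsto_integral_of_dominated_convergence (fun x => C * M * |γ x|)
      (fun k => (hcont k).aestronglyMeasurable.mul hγ.aestronglyMeasurable)
      (hγ.abs.const_mul _) (fun k => Eventually.of_forall fun x => ?_) ?_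
    · rw [norm_mul]
      exact mul_le_mul_of_nonneg_right (hbd k x) (norm_nonneg _)
    · filter_upwards [hmae] with x hx
      exact (((hψ'.tendsto _).comp hx).mul_const _).mul_const _
  have hlim4 : Tendsto (fun k => ∫ x, deriv ψ (m k x) * n k x * φ x) atTop
      (𝓝 (∫ x, (deriv ψ (U x) * φ x) * γ x)) := by
    have := hlim2.add hlim3
    rw [zero_add] at this
    refine this.congr fun k => ?_
    have hdiff : Integrable fun x => n k x - γ x := (hnint k).sub hγ
    rw [← integral_add
      (hdiff.bdd_mul (hcont k).aestronglyMeasurable (Eventually.of_forall (hbd k)))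
      (hγ.bdd_mul (hcont k).aestronglyMeasurable (Eventually.of_forall (hbd k)))]
    refine integral_congr_ae (Eventually.of_forall fun x => ?_)
    ring
  have hmain : ∫ x, ψ (U x) * fderiv ℝ φ x e = - ∫ x, (deriv ψ (U x) * φ x) * γ x :=
    tendsto_nhds_unique (hlim1.congr' hparts) hlim4.neg
  have hz : ∀ x, x ∉ Ω → φ x = 0 := fun x hx =>
    image_eq_zero_of_notMem_tsupport fun h' => hx (hφΩ h')
  have hzd : ∀ x, x ∉ Ω → fderiv ℝ φ x e = 0 := fun x hx => by
    rw [fderiv_of_notMem_tsupport ℝ fun h' => hx (hφΩ h')]; rfl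
  calc ∫ x in Ω, ψ (u x) * fderiv ℝ φ x e
      = ∫ x in Ω, ψ (U x) * fderiv ℝ φ x e :=
        setIntegral_congr_fun hΩ.measurableSet fun x hx => by simp [hUdef, hx]
    _ = - ∫ x, (deriv ψ (U x) * φ x) * γ x := by
        rw [← hmain]
        exact setIntegral_eq_integral_of_forall_compl_eq_zero
          fun x hx => by rw [hzd x hx, mul_zero]
    _ = - ∫ x in Ω, (deriv ψ (U x) * φ x) * γ x := by
        rw [setIntegral_eq_integral_of_forall_compl_eq_zero
          fun x hx => by rw [hz x hx, mul_zero, zero_mul]]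
    _ = - ∫ x in Ω, deriv ψ (u x) * g x i * φ x := by
        rw [setIntegral_congr_fun hΩ.measurableSet fun x hx => ?_]
        simp only [hUdef, hγdef, indicator_of_mem hx]
        ring

/-- Chain rule in `H¹(Ω)` for outer functions that are bounded together with their derivative. -/
theorem HasH1Gradient.comp {d : ℕ} {Ω : Set (Space d)} {u : Space d → ℝ}
    {g : Space d → Space d} (h : HasH1Gradient Ω u g) (hΩ : IsOpen Ω) (hΩfin : volume Ω < ⊤)
    {ψ : ℝ → ℝ} (hψ : ContDiff ℝ 1 ψ) {C : ℝ}
    (hψC : ∀ s, |ψ s| ≤ C) (hψC' : ∀ s, |deriv ψ s| ≤ C) :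
    HasH1Gradient Ω (fun x => ψ (u x)) (fun x => deriv ψ (u x) • g x) := by
  have : IsFiniteMeasure (volume.restrict Ω) := ⟨by simpa using hΩfin⟩
  have hu : IntegrableOn u Ω := h.memLp.integrable one_le_two
  have hg : IntegrableOn g Ω := h.memLp_grad.integrable one_le_two
  have h1 : MemLp (fun x => ψ (u x)) 2 (volume.restrict Ω) :=
    MemLp.of_bound (hψ.continuous.comp_aestronglyMeasurable h.memLp.1) C
      (Filter.Eventually.of_forall fun x => hψC _)
  have h2 : MemLp (fun x => deriv ψ (u x) • g x) 2 (volume.restrict Ω) :=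
    h.memLp_grad.of_le_mul (c := C)
      ((hψ.continuous_deriv_one.comp_aestronglyMeasurable h.memLp.1).smul h.memLp_grad.1)
      (Filter.Eventually.of_forall fun x => by
        rw [norm_smul]
        exact mul_le_mul_of_nonneg_right (hψC' _) (norm_nonneg _))
  refine ⟨h1, h2, IntegrableOn.locallyIntegrableOn (h1.integrable one_le_two),
    IntegrableOn.locallyIntegrableOn (h2.integrable one_le_two), fun φ hφ hφs hφΩ i => ?_⟩
  simpa using h.isWeakGradient.integral_comp_mul_fderiv hΩ hu hg hψ hψC hψC' hφ hφs hφΩ i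

/-! ### Weak maximum principle -/

theorem MeasureTheory.MemLp.integrable_real_inner {X E : Type*} [MeasurableSpace X]
    {μ : Measure X} [NormedAddCommGroup E] [InnerProductSpace ℝ E] {f g : X → E}
    (hf : MemLp f 2 μ) (hg : MemLp g 2 μ) : Integrable (fun x => inner ℝ (f x) (g x)) μ :=
  memLp_one_iff_integrable.1 <| MemLp.of_bilin (fun a b => inner ℝ a b) 1 hf hg
    (hf.1.inner hg.1) (Filter.Eventually.of_forall fun x => by
      simpa using nnnorm_inner_le_nnnorm (𝕜 := ℝ) (f x) (g x))

/-- Weak maximum principle with a smooth test function. If `ψ` is nondecreasing, the diffusion term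
`κ ψ'(u) |∇u|²` is nonnegative; when the reaction term `r ψ(u)` is positive wherever `ψ(u) ≠ 0`,
the weak equation tested with `ψ(u)` forces `ψ(u) = 0`. -/
theorem HasH1Gradient.comp_ae_eq_zero {d : ℕ} {Ω : Set (Space d)} {u : Space d → ℝ}
    {g : Space d → Space d} (h : HasH1Gradient Ω u g) (hΩ : IsOpen Ω) (hΩfin : volume Ω < ⊤)
    {ψ : ℝ → ℝ} (hψ : ContDiff ℝ 1 ψ) {C : ℝ} (hψC : ∀ s, |ψ s| ≤ C)
    (hψC' : ∀ s, |deriv ψ s| ≤ C) (hmono : Monotone ψ) {κ : ℝ} (hκ : 0 ≤ κ)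
    {r : Space d → ℝ} (hr : IntegrableOn r Ω)
    (hweak : ∫ x in Ω, (r x * ψ (u x) + κ * inner ℝ (g x) (deriv ψ (u x) • g x)) = 0)
    (hsign : ∀ᵐ x ∂(volume.restrict Ω), ψ (u x) ≠ 0 → 0 < r x * ψ (u x)) :
    ∀ᵐ x ∂(volume.restrict Ω), ψ (u x) = 0 := by
  have hc := h.comp hΩ hΩfin hψ hψC hψC'
  have hi1 : IntegrableOn (fun x => r x * ψ (u x)) Ω :=
    Integrable.mul_bdd (c := C) hr hc.memLp.1 (Filter.Eventually.of_forall fun x => hψC _)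
  have hi2 : IntegrableOn (fun x => κ * inner ℝ (g x) (deriv ψ (u x) • g x)) Ω :=
    (h.memLp_grad.integrable_real_inner hc.memLp_grad).const_mul κ
  have hgrad : ∀ x, 0 ≤ κ * inner ℝ (g x) (deriv ψ (u x) • g x) := fun x => by
    rw [real_inner_smul_right]
    exact mul_nonneg hκ (mul_nonneg hmono.deriv_nonneg real_inner_self_nonneg)
  have hreac : ∀ᵐ x ∂(volume.restrict Ω), 0 ≤ r x * ψ (u x) := by
    filter_upwards [hsign] with x hx
    by_cases h0 : ψ (u x) = 0
    · simp [h0]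
    · exact (hx h0).le
  have hzero := (integral_eq_zero_iff_of_nonneg_ae
    (by filter_upwards [hreac] with x hx using add_nonneg hx (hgrad x)) (hi1.add hi2)).1 hweak
  filter_upwards [hzero, hreac, hsign] with x h0 h1 h2
  by_contra hne
  -- The sum of the two nonnegative terms vanishes, but the first is positive.
  have : r x * ψ (u x) + κ * inner ℝ (g x) (deriv ψ (u x) • g x) = 0 := h0
  linarith [h2 hne, hgrad x]

/-- A common bound for `Real.smoothTransition` (by `1 ≤ C`) and its derivative, which is continuous
and vanishes outside `[0, 1]`. -/
theorem exists_bound_smoothTransition_deriv :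
    ∃ C : ℝ, 1 ≤ C ∧ ∀ s, |deriv Real.smoothTransition s| ≤ C := by
  have hc : Continuous (deriv Real.smoothTransition) :=
    (Real.smoothTransition.contDiff (n := 1)).continuous_deriv_one
  have hs : HasCompactSupport (deriv Real.smoothTransition) := by
    refine HasCompactSupport.intro (isCompact_Icc (a := (0 : ℝ)) (b := 1)) fun x hx => ?_
    have : Real.smoothTransition =ᶠ[nhds x] fun _ => Real.smoothTransition x := by
      rcases lt_or_ge x 0 with h | h
      · filter_upwards [Iio_mem_nhds h] with y hy
        rw [Real.smoothTransition.zero_of_nonpos (le_of_lt hy),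
          Real.smoothTransition.zero_of_nonpos h.le]
      · have h1 : 1 < x := by
          by_contra hcon
          exact hx ⟨h, not_lt.1 hcon⟩
        filter_upwards [Ioi_mem_nhds h1] with y hy
        rw [Real.smoothTransition.one_of_one_le (le_of_lt hy),
          Real.smoothTransition.one_of_one_le h1.le]
    rw [this.deriv_eq, deriv_const]
  obtain ⟨C, hC⟩ := hs.exists_bound_of_continuous hc
  exact ⟨max C 1, le_max_right _ _, fun s => (hC s).trans (le_max_left _ _)⟩

/-! ### Continuity of the coefficients -/

theorem aestronglyMeasurable_and_bdd_comp_of_continuousOn_Icc {X : Type*} [MeasurableSpace X]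
    {μ : Measure X} {a b : ℝ} (hab : a ≤ b) {f : ℝ → ℝ} (hf : ContinuousOn f (Icc a b))
    {w : X → ℝ} (hw : AEMeasurable w μ) (hrange : ∀ᵐ x ∂μ, w x ∈ Icc a b) :
    AEStronglyMeasurable (fun x => f (w x)) μ ∧ ∃ C, ∀ᵐ x ∂μ, ‖f (w x)‖ ≤ C := by
  constructor
  · have hext : Continuous (IccExtend hab ((Icc a b).domRestrict f)) := hf.domRestrict.Icc_extend'
    refine (hext.measurable.comp_aemeasurable hw).aestronglyMeasurable.congr ?_
    filter_upwards [hrange] with x hx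
    exact IccExtend_of_mem hab _ hx
  · obtain ⟨C, hC⟩ := isCompact_Icc.exists_bound_of_continuousOn hf
    exact ⟨C, by filter_upwards [hrange] with x hx using hC _ hx⟩

namespace PRFluid

variable (F : PRFluid)

/-- `G` and `G'` are continuous where `0 < c < 1 / β`: there `λ c - c ln(1 - β c)` is smooth and
positive, so that the square root is differentiable. -/
theorem continuousOn_G_G' (hβ : 0 < F.β) {lam : ℝ} (hlam : 0 < lam) :
    ContinuousOn (F.G lam) {c | 0 < c ∧ F.β * c < 1} ∧
      ContinuousOn (F.G' lam) {c | 0 < c ∧ F.β * c < 1} := by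
  have hopen : IsOpen {c : ℝ | 0 < c ∧ F.β * c < 1} :=
    (isOpen_lt continuous_const continuous_id).inter
      (isOpen_lt (continuous_const.mul continuous_id) continuous_const)
  have hsm : ContDiffOn ℝ 1 (F.G lam) {c | 0 < c ∧ F.β * c < 1} := by
    have hlog : ContDiffOn ℝ 1 (fun c => Real.log (1 - F.β * c)) {c | 0 < c ∧ F.β * c < 1} :=
      ContDiffOn.log (by fun_prop) fun c hc => (sub_pos.2 hc.2).ne'
    refine ContDiffOn.sqrt (f := fun c => lam * c - c * Real.log (1 - F.β * c))
      ((contDiff_const.mul contDiff_id).contDiffOn.sub (contDiffOn_id.mul hlog)) fun c hc => ?_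
    have h1 : Real.log (1 - F.β * c) ≤ 0 :=
      Real.log_nonpos (sub_nonneg.2 hc.2.le) (by nlinarith [mul_pos hβ hc.1])
    have h2 := mul_nonpos_of_nonneg_of_nonpos hc.1.le h1
    have h3 := mul_pos hlam hc.1
    exact (by linarith : 0 < lam * c - c * Real.log (1 - F.β * c)).ne'
  exact ⟨hsm.continuousOn, hsm.continuousOn_deriv_of_isOpen hopen le_rfl⟩

theorem continuousOn_muAttraction (hβ : 0 < F.β) :
    ContinuousOn F.muAttraction {c | 0 < c ∧ F.β * c < 1} := by
  have h2 : (1 : ℝ) ≤ √2 := Real.one_le_sqrt.2 (by norm_num)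
  have h2' : √2 ≤ 2 := Real.sqrt_le_iff.2 (by norm_num)
  have hpos : ∀ c ∈ {c : ℝ | 0 < c ∧ F.β * c < 1}, 0 < F.β * c := fun c hc => mul_pos hβ hc.1
  have hnum : ∀ c ∈ {c : ℝ | 0 < c ∧ F.β * c < 1}, 0 < 1 + (1 - √2) * F.β * c := fun c hc => by
    nlinarith [hpos c hc, hc.2]
  have hden : ∀ c ∈ {c : ℝ | 0 < c ∧ F.β * c < 1}, 0 < 1 + (1 + √2) * F.β * c := fun c hc => by
    nlinarith [hpos c hc, hc.2]
  have hquad : ∀ c ∈ {c : ℝ | 0 < c ∧ F.β * c < 1}, 0 < 1 + 2 * F.β * c - (F.β * c) ^ 2 :=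
    fun c hc => by nlinarith [hpos c hc, hc.2]
  refine ContinuousOn.sub (continuousOn_const.mul (ContinuousOn.log
    (ContinuousOn.div (by fun_prop) (by fun_prop) fun c hc => (hden c hc).ne') fun c hc =>
    (div_pos (hnum c hc) (hden c hc)).ne')) (ContinuousOn.div (by fun_prop) (by fun_prop)
    fun c hc => (hquad c hc).ne')

theorem continuousOn_nu (hβ : 0 < F.β) {lam : ℝ} (hlam : 0 < lam) :
    ContinuousOn (F.nu lam) {c | 0 < c ∧ F.β * c < 1} :=
  continuousOn_const.mul ((continuousOn_const.div continuousOn_id fun _ hc => hc.1.ne').add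
    ((F.continuousOn_G_G' hβ hlam).2.pow 2))

theorem continuousOn_sr (hβ : 0 < F.β) {lam : ℝ} (hlam : 0 < lam) :
    ContinuousOn (F.sr lam) {c | 0 < c ∧ F.β * c < 1} := by
  obtain ⟨hG, hG'⟩ := F.continuousOn_G_G' hβ hlam
  have hlog : ContinuousOn Real.log {c | 0 < c ∧ F.β * c < 1} :=
    continuousOn_id.log fun _ hc => hc.1.ne'
  exact ((continuousOn_const.sub (continuousOn_const.mul hlog)).add (continuousOn_const.mul
    ((((hG'.pow 2).mul continuousOn_id).sub ((continuousOn_const.mul hG).mul hG')).add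
      continuousOn_const))).sub (F.continuousOn_muAttraction hβ)

/-- The chemical potential at the new step is affine in the new concentration. -/
theorem mu_sum_eq_nu_mul_sub_sr (lam c0 c1 : ℝ) :
    F.muIdeal c0 c1 + F.muRepulsion lam c0 c1 + F.muAttraction c0
      = F.nu lam c0 * c1 - F.sr lam c0 := by
  simp only [muIdeal, muRepulsion, nu, sr]
  ring

end PRFluid

/-! ### Bounds on the concentration -/

theorem theorem4p2 {d : ℕ} (Ω : Set (Space d)) (hΩ : IsOpen Ω) (hΩfin : volume Ω < ⊤)
    (F : PRFluid) (hR : 0 < F.R) (hT : 0 < F.T) (hβ : 0 < F.β) (hκ : 0 < F.κ)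
    (cm cM ε₀ : ℝ) (hcm : 0 < cm) (hcM : cm ≤ cM) (hβcM : F.β * cM ≤ ε₀) (hε₀ : ε₀ < 1)
    (lam : ℝ)
    (hlam : ε₀ / (1 - ε₀) ^ 2
        + √(ε₀ ^ 2 / (1 - ε₀) ^ 4 - 2 * Real.log (1 - ε₀) * (ε₀ / (1 - ε₀) ^ 2)) ≤ lam)
    (τ ct : ℝ) (hτ : 0 < τ) (hct : 0 < ct)
    (c0 : Space d → ℝ) (hc0 : AEMeasurable c0 (volume.restrict Ω))
    (hrange : ∀ᵐ x ∂(volume.restrict Ω), cm ≤ c0 x ∧ c0 x ≤ cM)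
    (c1 : Space d → ℝ) (μe : ℝ) (hstep : F.IsWeakStep Ω lam τ ct c0 c1 μe)
    (hlower : sSup ((fun c => cm * F.nu lam c - F.sr lam c) '' Icc cm cM) ≤ μe)
    (hupper : μe ≤ sInf ((fun c => cM * F.nu lam c - F.sr lam c) '' Icc cm cM)) :
    ∀ᵐ x ∂(volume.restrict Ω), cm ≤ c1 x ∧ c1 x ≤ cM := by
  have : IsFiniteMeasure (volume.restrict Ω) := ⟨by simpa using hΩfin⟩
  have hε₀pos : 0 < ε₀ := (mul_pos hβ (hcm.trans_le hcM)).trans_le hβcM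
  have hlampos : 0 < lam := by
    have h1 : 0 < ε₀ / (1 - ε₀) ^ 2 := div_pos hε₀pos (pow_pos (sub_pos.2 hε₀) 2)
    linarith [Real.sqrt_nonneg
      (ε₀ ^ 2 / (1 - ε₀) ^ 4 - 2 * Real.log (1 - ε₀) * (ε₀ / (1 - ε₀) ^ 2))]
  have hsub : Icc cm cM ⊆ {c | 0 < c ∧ F.β * c < 1} := fun c hc =>
    ⟨hcm.trans_le hc.1, ((mul_le_mul_of_nonneg_left hc.2 hβ.le).trans hβcM).trans_lt hε₀⟩
  have hνc : ContinuousOn (F.nu lam) (Icc cm cM) := (F.continuousOn_nu hβ hlampos).mono hsub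
  have hsc : ContinuousOn (F.sr lam) (Icc cm cM) := (F.continuousOn_sr hβ hlampos).mono hsub
  have hνnn : ∀ c ∈ Icc cm cM, 0 ≤ F.nu lam c := fun c hc =>
    mul_nonneg (mul_pos hR hT).le
      (add_nonneg (one_div_nonneg.2 (hsub hc).1.le) (sq_nonneg _))
  -- By compactness of `[cm, cM]` the `sSup` and `sInf` are genuine bounds, not the junk value `0`
  -- of an unbounded set.
  have hlo : ∀ c ∈ Icc cm cM, cm * F.nu lam c - F.sr lam c ≤ μe := fun c hc =>
    (le_csSup (isCompact_Icc.bddAbove_image ((continuousOn_const.mul hνc).sub hsc))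
      (mem_image_of_mem _ hc)).trans hlower
  have hup : ∀ c ∈ Icc cm cM, μe ≤ cM * F.nu lam c - F.sr lam c := fun c hc =>
    hupper.trans (csInf_le (isCompact_Icc.bddBelow_image ((continuousOn_const.mul hνc).sub hsc))
      (mem_image_of_mem _ hc))
  obtain ⟨⟨g, hg, hweak⟩, -⟩ := hstep
  obtain ⟨hνm, Cν, hνb⟩ := aestronglyMeasurable_and_bdd_comp_of_continuousOn_Icc hcM hνc hc0 hrange
  obtain ⟨hsm, Cs, hsb⟩ := aestronglyMeasurable_and_bdd_comp_of_continuousOn_Icc hcM hsc hc0 hrange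
  obtain ⟨him, Ci, hib⟩ :=
    aestronglyMeasurable_and_bdd_comp_of_continuousOn_Icc hcM continuousOn_id hc0 hrange
  have hc1i : IntegrableOn c1 Ω := hg.memLp.integrable one_le_two
  set r : Space d → ℝ := fun x =>
    (c1 x - c0 x) / τ + (F.nu lam (c0 x) * c1 x - F.sr lam (c0 x)) - μe with hrdef
  have hr : IntegrableOn r Ω :=
    (((hc1i.sub (Integrable.of_bound him Ci hib)).div_const τ).add
      ((hc1i.bdd_mul hνm hνb).sub (Integrable.of_bound hsm Cs hsb))).sub (integrable_const μe)
  -- The weak form tested with `ψ ∘ c1`. All terms are integrable, so the right-hand side `μe` can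
  -- be absorbed into `r`.
  have htest : ∀ {ψ : ℝ → ℝ} {C : ℝ}, ContDiff ℝ 1 ψ → (∀ s, |ψ s| ≤ C) →
      (∀ s, |deriv ψ s| ≤ C) →
      ∫ x in Ω, (r x * ψ (c1 x) + F.κ * inner ℝ (g x) (deriv ψ (c1 x) • g x)) = 0 := by
    intro ψ C hψ hψC hψC'
    have hv := hg.comp hΩ hΩfin hψ hψC hψC'
    have hi1 : IntegrableOn (fun x => r x * ψ (c1 x)) Ω :=
      Integrable.mul_bdd (c := C) hr hv.memLp.1 (Filter.Eventually.of_forall fun x => hψC _)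
    have hi2 : IntegrableOn (fun x => F.κ * inner ℝ (g x) (deriv ψ (c1 x) • g x)) Ω :=
      (hg.memLp_grad.integrable_real_inner hv.memLp_grad).const_mul F.κ
    have hi3 : IntegrableOn (fun x => μe * ψ (c1 x)) Ω :=
      (hv.memLp.integrable one_le_two).const_mul μe
    have hi12 : IntegrableOn
        (fun x => r x * ψ (c1 x) + F.κ * inner ℝ (g x) (deriv ψ (c1 x) • g x)) Ω := hi1.add hi2
    have hw := hweak _ _ hv
    have hsplit : ∀ x, (c1 x - c0 x) / τ * ψ (c1 x)
          + F.κ * inner ℝ (g x) (deriv ψ (c1 x) • g x)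
          + (F.muIdeal (c0 x) (c1 x) + F.muRepulsion lam (c0 x) (c1 x)
              + F.muAttraction (c0 x)) * ψ (c1 x)
        = (r x * ψ (c1 x) + F.κ * inner ℝ (g x) (deriv ψ (c1 x) • g x)) + μe * ψ (c1 x) :=
      fun x => by rw [F.mu_sum_eq_nu_mul_sub_sr]; simp only [hrdef]; ring
    simp_rw [hsplit] at hw
    rw [integral_add hi12 hi3] at hw
    linarith
  obtain ⟨C, hC1, hC⟩ := exists_bound_smoothTransition_deriv
  have hS : ContDiff ℝ 1 Real.smoothTransition := Real.smoothTransition.contDiff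
  have hSb : ∀ s, |Real.smoothTransition s| ≤ C := fun s => by
    rw [abs_of_nonneg (Real.smoothTransition.nonneg s)]
    exact (Real.smoothTransition.le_one s).trans hC1
  -- Where `cM < c1`, `r = (c1 - c0) / τ + ν (c1 - cM) + (cM ν - s_r - μe)` has a positive first term
  -- and nonnegative others.
  have hU : ∀ᵐ x ∂(volume.restrict Ω), Real.smoothTransition (c1 x - cM) = 0 := by
    have hψ : ContDiff ℝ 1 fun s => Real.smoothTransition (s - cM) :=
      hS.comp (contDiff_id.sub contDiff_const)
    have hψC : ∀ s, |Real.smoothTransition (s - cM)| ≤ C := fun s => hSb _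
    have hψC' : ∀ s, |deriv (fun s => Real.smoothTransition (s - cM)) s| ≤ C := fun s => by
      rw [deriv_comp_sub_const]
      exact hC _
    refine hg.comp_ae_eq_zero hΩ hΩfin (ψ := fun s => Real.smoothTransition (s - cM)) hψ hψC hψC'
      (fun s t hst => Real.smoothTransition.monotone (by linarith)) hκ.le hr
      (htest hψ hψC hψC') ?_
    filter_upwards [hrange] with x hx hne
    have hlt : 0 < c1 x - cM := by
      by_contra hcon
      exact hne (Real.smoothTransition.zero_of_nonpos (not_lt.1 hcon))
    refine mul_pos ?_ (Real.smoothTransition.pos_of_pos hlt)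
    have h1 : 0 < (c1 x - c0 x) / τ := div_pos (by linarith [hx.2]) hτ
    have h2 := hup _ hx
    have h3 := mul_nonneg (hνnn _ hx) hlt.le
    simp only [hrdef]
    linarith
  -- Where `c1 < cm`, the same decomposition around `cm` shows `r < 0`.
  have hL : ∀ᵐ x ∂(volume.restrict Ω), -Real.smoothTransition (cm - c1 x) = 0 := by
    have hψ : ContDiff ℝ 1 fun s => -Real.smoothTransition (cm - s) :=
      (hS.comp (contDiff_const.sub contDiff_id)).neg
    have hψC : ∀ s, |-Real.smoothTransition (cm - s)| ≤ C := fun s => by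
      rw [abs_neg]
      exact hSb _
    have hψC' : ∀ s, |deriv (fun s => -Real.smoothTransition (cm - s)) s| ≤ C := fun s => by
      rw [deriv.fun_neg, deriv_comp_const_sub, neg_neg]
      exact hC _
    refine hg.comp_ae_eq_zero hΩ hΩfin (ψ := fun s => -Real.smoothTransition (cm - s)) hψ hψC hψC'
      (fun s t hst => neg_le_neg (Real.smoothTransition.monotone (by linarith))) hκ.le hr
      (htest hψ hψC hψC') ?_
    filter_upwards [hrange] with x hx hne
    have hlt : 0 < cm - c1 x := by
      by_contra hcon
      exact hne (by rw [Real.smoothTransition.zero_of_nonpos (not_lt.1 hcon), neg_zero])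
    refine mul_pos_of_neg_of_neg ?_ (neg_neg_of_pos (Real.smoothTransition.pos_of_pos hlt))
    have h1 : (c1 x - c0 x) / τ < 0 := div_neg_of_neg_of_pos (by linarith [hx.1]) hτ
    have h2 := hlo _ hx
    have h3 := mul_nonneg (hνnn _ hx) hlt.le
    simp only [hrdef]
    linarith
  filter_upwards [hU, hL] with x h1 h2
  rw [neg_eq_zero] at h2
  exact ⟨by linarith [Real.smoothTransition.zero_iff_nonpos.1 h2],
    by linarith [Real.smoothTransition.zero_iff_nonpos.1 h1]⟩
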